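/- Let $d\ge 1$, let $g\in L^2(\mathbb{R}^d)$ with $\|g\|_2=1$, and let $\Omega\subset\mathbb{R}^{2d}$ be compact. For $f\in L^2(\mathbb{R}^d)$ write $V_gf(x,\xi)=\int_{\mathbb{R}^d}f(t)\overline{g(t-x)}e^{-2\pi i\xi\cdot t}\,dt$, $(x,\xi)\in\mathbb{R}^d\times\mathbb{R}^d$. For a compact set $K\subset\mathbb{R}^{2d}$ let $L_K$ be the localization operator on $L^2(\mathbb{R}^d)$ given by $$L_Kf=\int_K V_gf(x,\xi)\,g(\cdot-x)e^{2\pi i\xi\cdot(\cdot)}\,dx\,d\xi .$$ Then for every $R>0$ the operator $L_{R\cdot\Omega}$ can be diagonalized as $$L_{R\cdot\Omega}f=\sum_{k\ge1}\lambda_k^{R\cdot\Omega}\,\langle f,h_k^{R\cdot\Omega}\rangle\, h_k^{R\cdot\Omega},\qquad f\in L^2(\mathbb{R}^d),$$ where $\lambda_1^{R\cdot\Omega}\ge\lambda_2^{R\cdot\Omega}\ge\dots>0$ is the finite or infinite list of its non-zero eigenvalues, repeated according to multiplicity, and the $h_k^{R\cdot\Omega}$ are corresponding orthonormal eigenfunctions.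 For each $R>0$ choose any such diagonalization and let $$\rho_{R\cdot\Omega}(z)=\sum_{k=1}^{A_{R\cdot\Omega}}\bigl|V_gh_k^{R\cdot\Omega}(z)\bigr|^2,\qquad A_{R\cdot\Omega}=\lceil |R\cdot\Omega|\rceil,$$ where $|\cdot|$ is Lebesgue measure and terms with an index beyond a finite list are read as $0$. Then, for every such choice, the functions $z\mapsto\rho_{R\cdot\Omega}(Rz)$, $R>0$, are integrable and $$\rho_{R\cdot\Omega}(R\,\cdot)\longrightarrow 1_\Omega\quad\text{in }L^1(\mathbb{R}^{2d}),\text{ as }R\to+\infty .$$ In particular, the limit does not depend on $g$. -/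

import Mathlib

open MeasureTheory Filter Topology
open scoped Pointwise

noncomputable section

/-- The Euclidean space `ℝ^d`. -/
abbrev Rn (d : ℕ) : Type := EuclideanSpace ℝ (Fin d)

/-- Phase space `ℝ^{2d} = ℝ^d × ℝ^d`, with points `z = (x, ξ)` and Lebesgue measure. -/
abbrev Phase (d : ℕ) : Type := Rn d × Rn d

/-- The complex Hilbert space `L²(ℝ^d)`. -/
abbrev L2 (d : ℕ) : Type := Lp ℂ 2 (volume : Measure (Rn d))

/-- The short-time Fourier transform
`V_g f (x, ξ) = ∫ f(t) conj(g(t - x)) e^{-2πi ξ·t} dt`. -/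
def stft {d : ℕ} (g f : L2 d) (z : Phase d) : ℂ :=
  ∫ t : Rn d, f t * (starRingEnd ℂ) (g (t - z.1)) *
    Complex.exp (-(2 * Real.pi * Complex.I * (inner ℝ z.2 t : ℝ)))

/-- The function `t ↦ g(t - x) e^{2πi ξ·t}` is square integrable. -/
theorem memLp_tfShift {d : ℕ} (z : Phase d) (g : L2 d) :
    MemLp (fun t : Rn d => g (t - z.1) * Complex.exp (2 * Real.pi * Complex.I * (inner ℝ z.2 t : ℝ)))
      2 volume := by
  have h1 : MemLp (fun t : Rn d => g (t - z.1)) 2 volume :=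
    (Lp.memLp g).comp_measurePreserving (measurePreserving_sub_right volume z.1)
  have hc : Continuous
      (fun t : Rn d => Complex.exp (2 * Real.pi * Complex.I * (inner ℝ z.2 t : ℝ))) := by
    fun_prop
  refine h1.congr_norm (h1.1.mul hc.aestronglyMeasurable) (Eventually.of_forall fun t => ?_)
  have h2 : (2 * Real.pi * Complex.I * (inner ℝ z.2 t : ℝ) : ℂ)
      = ((2 * Real.pi * inner ℝ z.2 t : ℝ) : ℂ) * Complex.I := by
    push_cast; ring
  rw [norm_mul, h2, Complex.norm_exp_ofReal_mul_I, mul_one]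

/-- The time-frequency shift of `g` by `z = (x, ξ)`: the element `t ↦ g(t - x) e^{2πi ξ·t}`
of `L²(ℝ^d)`. -/
def tfShift {d : ℕ} (z : Phase d) (g : L2 d) : L2 d :=
  (memLp_tfShift z g).toLp _

/-- The time-frequency localization operator with window `g` and symbol `Ω`,
`L_Ω f = ∫_Ω V_g f(x, ξ) g(· - x) e^{2πi ξ·(·)} dx dξ`, as an `L²(ℝ^d)`-valued (Bochner) integral.
For compact `Ω` the integrand is norm continuous, hence the integral converges absolutely. -/
def locOp {d : ℕ} (g : L2 d) (Ω : Set (Phase d)) (f : L2 d) : L2 d :=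
  ∫ z in Ω, stft g f z • tfShift z g

/-- `lam` and `h` list (from index `0` on) the non-zero eigenvalues of the positive operator `L_Ω`,
repeated according to multiplicity and in non-increasing order, and a corresponding orthonormal set
of eigenfunctions which diagonalizes `L_Ω`:
`L_Ω f = ∑_k lam_k ⟨f, h_k⟩ h_k`. If there are only finitely many non-zero eigenvalues, both
sequences are continued by `0`. -/
structure IsEigensystem {d : ℕ} (g : L2 d) (Ω : Set (Phase d)) (lam : ℕ → ℝ) (h : ℕ → L2 d) :
    Prop where
  nonneg : ∀ k, 0 ≤ lam k
  antitone : Antitone lam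
  orthonormal : Orthonormal ℂ (fun k : {k : ℕ // lam k ≠ 0} => h k)
  eq_zero : ∀ k, lam k = 0 → h k = 0
  diag : ∀ f : L2 d, HasSum (fun k => ((lam k : ℂ) * inner ℂ (h k) f) • h k) (locOp g Ω f)

/-- `A_Ω = ⌈|Ω|⌉`, the smallest integer greater than or equal to the Lebesgue measure of `Ω`. -/
def ceilVol {d : ℕ} (Ω : Set (Phase d)) : ℕ := ⌈(volume Ω).toReal⌉₊

/-- The accumulated spectrogram `ρ_Ω(z) = ∑_k |V_g h_k (z)|²`, the sum running over the first `A_Ω`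
eigenfunctions `h_k` of `L_Ω`. -/
def accSpec {d : ℕ} (g : L2 d) (Ω : Set (Phase d)) (h : ℕ → L2 d) (z : Phase d) : ℝ :=
  ∑ k ∈ Finset.range (ceilVol Ω), ‖stft g (h k) z‖ ^ 2

end

/-!
The idea is that the accumulated spectrogram is a sharp cut-off of a sum which can be computed.
Write `π(z)` for time-frequency shifts, so that `V_g f(z) = ⟨f, π(z)g⟩`, and let `K = R • Ω`.
Evaluating `⟨L_K π(z)g, π(z)g⟩` once by the definition of `L_K` and once by the eigensystem gives

  `∑ λ_k |V_g h_k|² = 1_K * |V_g g|²`   (`IsEigensystem.hasSum_mul_norm_sq_stft`).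

By Moyal's identity (`lintegral_enorm_sq_stft`, proved from Plancherel's theorem in slices of phase
space) the functions `|V_g h_k|²` and `|V_g g|²` are probability densities. Integrating the identity
over phase space gives `∑ λ_k = |K|`; integrating it over `Kᶜ`, where `|V_g h_k|²` has mass
`1 - λ_k`, gives `∑ λ_k (1 - λ_k) = E` with the leakage `E = ∫_{Kᶜ} 1_K * |V_g g|²`. If `E` is
small compared with `|K|`, most eigenvalues are close to `0` or to `1`, and as the trace is `|K|`,
about `⌈|K|⌉` of them are close to `1`. Quantitatively (`sum_one_sub_add_tsum_le`),
`∑_{k < A} (1 - λ_k) + ∑_{k ≥ A} λ_k ≤ (A - |K|) + 2E` for `A = ⌈|K|⌉`, and this bounds the `L¹`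
distance from the accumulated spectrogram to `1_K * |V_g g|²`. The latter is at distance `2E` from
`1_K`, which yields `IsEigensystem.lintegral_accSpec_sub_indicator_le`.

It remains to see that `R^{-2d} E` tends to `0`. After rescaling,
`R^{-2d} E = ∫ |V_g g(u)|² |{w ∈ Ω : w + u/R ∉ Ω}| du`, and dominated convergence applies because
`|(Ω + v) \ Ω|` tends to `0` with `v` for compact `Ω`.

The eigensystem exists because `L_K` is a norm convergent integral of positive rank one operators,
hence positive and compact (`isCompactOperator_locCLM`); an ordered eigensystem of such an operator
is obtained by splitting off top eigenvectors one after the other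
(`exists_ordered_diagonalization`).
-/

/-! ### Compact positive operators -/

section Spectral

open InnerProductSpace

variable {H : Type*} [NormedAddCommGroup H] [InnerProductSpace ℂ H] [CompleteSpace H]

/-- The norm of a compact positive operator is attained as an eigenvalue. -/
theorem exists_eigenvector_norm {T : H →L[ℂ] H} (hc : IsCompactOperator T) (hp : T.IsPositive)
    (h0 : T ≠ 0) : ∃ h : H, ‖h‖ = 1 ∧ T h = (‖T‖ : ℂ) • h := by
  have hn : (‖T‖ : ℂ) ≠ 0 := by simpa using h0
  have : Nontrivial H := by
    by_contra hH
    rw [not_nontrivial_iff_subsingleton] at hH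
    exact h0 (by ext x; exact Subsingleton.elim _ _)
  have hspec : (‖T‖ : ℂ) ∈ spectrum ℂ T := by
    by_contra hs
    have hs' : algebraMap ℝ ℂ ‖T‖ ∈ resolventSet ℂ T := by
      simpa [spectrum] using hs
    obtain ⟨ε, hε, hle⟩ := T.rayleighQuotient_le_of_norm_mem_resolventSet hs'
    have h1 := T.norm_eq_iSup_rayleighQuotient hp.isSymmetric
    have h2 : ⨆ x, |T.rayleighQuotient x| ≤ ‖T‖ - ε := by
      refine ciSup_le fun x => ?_
      have h3 : 0 ≤ T.rayleighQuotient x := by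
        rw [ContinuousLinearMap.rayleighQuotient, ContinuousLinearMap.reApplyInnerSelf_apply]
        exact div_nonneg (hp.re_inner_nonneg_left x) (sq_nonneg _)
      rw [abs_of_nonneg h3]
      exact hle x
    linarith
  obtain ⟨v, hv⟩ := ((hc.hasEigenvalue_iff_mem_spectrum hn).2 hspec).exists_hasEigenvector
  have hv0 : ‖v‖ ≠ 0 := norm_ne_zero_iff.2 hv.2
  have hTv : T v = (‖T‖ : ℂ) • v := hv.apply_eq_smul
  refine ⟨((‖v‖ : ℂ)⁻¹) • v, ?_, ?_⟩
  · rw [norm_smul, norm_inv, Complex.norm_real, norm_norm, inv_mul_cancel₀ hv0]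
  · rw [map_smul, hTv, smul_comm]

/-- Splitting off a top eigenvector `h` from a compact positive operator `T` leaves a compact
positive operator `T'` of smaller norm which vanishes on `h` and on the kernel of `T`. -/
theorem exists_deflation {T : H →L[ℂ] H} (hT : IsCompactOperator T ∧ T.IsPositive) :
    ∃ (h : H) (T' : H →L[ℂ] H), (IsCompactOperator T' ∧ T'.IsPositive) ∧
      (∀ x, T' x = T x - ((‖T‖ : ℂ) * inner ℂ h x) • h) ∧ ‖T'‖ ≤ ‖T‖ ∧
      T h = (‖T‖ : ℂ) • h ∧ (T ≠ 0 → ‖h‖ = 1) ∧ (T = 0 → h = 0) ∧ T' h = 0 ∧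
      ∀ x, T x = 0 → T' x = 0 := by
  by_cases h0 : T = 0
  · subst h0
    exact ⟨0, 0, hT, by simp, le_rfl, by simp, by simp, by simp, by simp, by simp⟩
  obtain ⟨hc, hp⟩ := hT
  obtain ⟨h, hn, hTh⟩ := exists_eigenvector_norm hc hp h0
  have hhh : inner ℂ h h = (1 : ℂ) := by rw [inner_self_eq_norm_sq_to_K, hn]; simp
  have hsymm : ∀ x y, inner ℂ (T x) y = inner ℂ x (T y) := hp.inner_left_eq_inner_right
  let T' : H →L[ℂ] H := T ∘L (ContinuousLinearMap.id ℂ H - rankOne ℂ h h)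
  have hT'y : ∀ x, T' x = T (x - inner ℂ h x • h) := fun x => by simp [T']
  have hT' : ∀ x, T' x = T x - ((‖T‖ : ℂ) * inner ℂ h x) • h := fun x => by
    rw [hT'y, map_sub, map_smul, hTh, smul_smul, mul_comm]
  have hort : ∀ x, inner ℂ (x - inner ℂ h x • h) h = (0 : ℂ) := fun x => by
    rw [inner_sub_left, inner_smul_left, hhh, inner_conj_symm]; simp
  have hTort : ∀ x, inner ℂ (T (x - inner ℂ h x • h)) h = (0 : ℂ) := fun x => by
    rw [hsymm, hTh, inner_smul_right, hort, mul_zero]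
  refine ⟨h, T', ⟨hc.comp_clm _, ?_⟩, hT', ?_, hTh, fun _ => hn, fun h' => absurd h' h0, ?_, ?_⟩
  · refine (ContinuousLinearMap.isPositive_def).2 ⟨?_, fun x => ?_⟩
    · intro x y
      change inner ℂ (T' x) y = inner ℂ x (T' y)
      rw [hT', hT', inner_sub_left, inner_sub_right, hsymm, inner_smul_left, inner_smul_right,
        map_mul, inner_conj_symm, Complex.conj_ofReal]
      ring
    · have h1 : inner ℂ (T' x) x = inner ℂ (T (x - inner ℂ h x • h)) (x - inner ℂ h x • h) := by
        rw [hT'y, inner_sub_right (T (x - inner ℂ h x • h)), inner_smul_right, hTort, mul_zero,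
          sub_zero]
      rw [ContinuousLinearMap.reApplyInnerSelf_apply, h1]
      exact hp.re_inner_nonneg_left _
  · refine ContinuousLinearMap.opNorm_le_bound _ (norm_nonneg _) fun x => ?_
    rw [hT'y]
    refine (T.le_opNorm _).trans (mul_le_mul_of_nonneg_left ?_ (norm_nonneg _))
    have h2 := norm_add_sq (𝕜 := ℂ) (x - inner ℂ h x • h) (inner ℂ h x • h)
    rw [inner_smul_right, hort, sub_add_cancel] at h2
    simp only [mul_zero, map_zero, add_zero] at h2
    refine (sq_le_sq₀ (norm_nonneg _) (norm_nonneg _)).1 ?_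
    nlinarith [sq_nonneg ‖inner ℂ h x • h‖]
  · rw [hT', hhh, hTh]; simp
  · intro x hx
    have h3 : (‖T‖ : ℂ) * inner ℂ h x = 0 := by
      have := hsymm h x
      rw [hx, inner_zero_right, hTh, inner_smul_left, Complex.conj_ofReal] at this
      exact this
    rw [hT', hx, h3]; simp

/-- **Spectral theorem** for compact positive operators, with the eigenvalues listed in
non-increasing order and according to multiplicity. -/
theorem exists_ordered_diagonalization {T : H →L[ℂ] H} (hc : IsCompactOperator T)
    (hp : T.IsPositive) :
    ∃ (lam : ℕ → ℝ) (h : ℕ → H), (∀ k, 0 ≤ lam k) ∧ Antitone lam ∧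
      Orthonormal ℂ (fun k : {k : ℕ // lam k ≠ 0} => h k) ∧ (∀ k, lam k = 0 → h k = 0) ∧
      ∀ f : H, HasSum (fun k => ((lam k : ℂ) * inner ℂ (h k) f) • h k) (T f) := by
  choose v D hD hDapp hDnorm hv hv1 hv0 hDv hDker using
    fun T : {T : H →L[ℂ] H // IsCompactOperator T ∧ T.IsPositive} => exists_deflation T.2
  let S : ℕ → {T : H →L[ℂ] H // IsCompactOperator T ∧ T.IsPositive} :=
    fun n => Nat.rec ⟨T, hc, hp⟩ (fun _ U => ⟨D U, hD U⟩) n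
  have hS0 : (S 0).1 = T := rfl
  have hS : ∀ n, (S (n + 1)).1 = D (S n) := fun n => rfl
  set lam : ℕ → ℝ := fun n => ‖(S n).1‖ with hlam
  set h : ℕ → H := fun n => v (S n) with hh
  have hnn : ∀ k, 0 ≤ lam k := fun k => norm_nonneg _
  have hanti : Antitone lam := antitone_nat_of_succ_le fun n => hDnorm (S n)
  have hzero : ∀ k, lam k = 0 → h k = 0 := fun k hk => hv0 _ (norm_eq_zero.1 hk)
  have hone : ∀ k, lam k ≠ 0 → ‖h k‖ = 1 := fun k hk => hv1 _ fun h' => hk (by simp [hlam, h'])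
  have hker : ∀ n m, n < m → (S m).1 (h n) = 0 := by
    intro n m hnm
    induction m, hnm using Nat.le_induction with
    | base => exact hDv (S n)
    | succ m _ ih => exact hDker (S m) _ ih
  have horth_lt : ∀ n m, n < m → inner ℂ (h n) (h m) = (0 : ℂ) := by
    intro n m hnm
    by_cases hm : lam m = 0
    · rw [hzero m hm, inner_zero_right]
    have h1 : inner ℂ ((S m).1 (h n)) (h m) = inner ℂ (h n) ((S m).1 (h m)) :=
      (S m).2.2.inner_left_eq_inner_right _ _
    rw [hker n m hnm, inner_zero_left] at h1
    have h2 : (S m).1 (h m) = (lam m : ℂ) • h m := hv (S m)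
    rw [h2, inner_smul_right] at h1
    exact (mul_eq_zero.1 h1.symm).resolve_left (by exact_mod_cast hm)
  have horth : ∀ n m, n ≠ m → inner ℂ (h n) (h m) = (0 : ℂ) := by
    intro n m hnm
    rcases hnm.lt_or_gt with h1 | h1
    · exact horth_lt n m h1
    · rw [← inner_conj_symm, horth_lt m n h1, map_zero]
  have hon : Orthonormal ℂ (fun k : {k : ℕ // lam k ≠ 0} => h k) :=
    ⟨fun k => hone k k.2, fun i j hij => horth i j fun h' => hij (Subtype.ext h')⟩
  have hsum : ∀ n f, T f = (S n).1 f + ∑ k ∈ Finset.range n, ((lam k : ℂ) * inner ℂ (h k) f) • h k := by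
    intro n f
    induction n with
    | zero => simp [hS0]
    | succ n ih =>
      rw [Finset.sum_range_succ, ih, hS, hDapp]
      simp only [hlam, hh]
      abel
  have hT : ∀ n, T (h n) = (lam n : ℂ) • h n := by
    intro n
    rw [hsum n (h n), Finset.sum_eq_zero, add_zero]
    · exact hv (S n)
    · intro k hk
      rw [horth k n (Finset.mem_range.1 hk).ne, mul_zero, zero_smul]
  -- Otherwise the vectors `T (h n)` would stay apart from each other, against compactness.
  have hlim : Tendsto lam atTop (𝓝 0) := by
    have hconv := tendsto_atTop_ciInf hanti ⟨0, by rintro _ ⟨k, rfl⟩; exact hnn k⟩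
    set c := ⨅ i, lam i with hcdef
    have hcle : ∀ k, c ≤ lam k := fun k => ciInf_le ⟨0, by rintro _ ⟨k, rfl⟩; exact hnn k⟩ k
    have hc0 : 0 ≤ c := le_ciInf hnn
    rcases hc0.eq_or_lt with hc1 | hc1
    · rwa [← hc1] at hconv
    exfalso
    obtain ⟨K, hK, hsub⟩ := hc.image_closedBall_subset_compact (f := (T : H →ₗ[ℂ] H)) 1
    have hmem : ∀ n, T (h n) ∈ K := fun n =>
      hsub ⟨h n, by simpa using (hone n (hc1.trans_le (hcle n)).ne').le, rfl⟩
    obtain ⟨a, -, φ, hφ, hta⟩ := hK.tendsto_subseq hmem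
    have hca := hta.cauchySeq
    obtain ⟨N, hN⟩ := Metric.cauchySeq_iff'.1 hca c hc1
    have h1 := hN (N + 1) (Nat.le_succ N)
    have hne : φ (N + 1) ≠ φ N := (hφ (Nat.lt_succ_self N)).ne'
    simp only [Function.comp, dist_eq_norm] at h1
    have h2 : ‖T (h (φ (N + 1))) - T (h (φ N))‖ ^ 2
        = lam (φ (N + 1)) ^ 2 + lam (φ N) ^ 2 := by
      rw [hT, hT, norm_sub_sq (𝕜 := ℂ), inner_smul_left, inner_smul_right, horth _ _ hne,
        norm_smul, norm_smul, hone _ (hc1.trans_le (hcle _)).ne',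
        hone _ (hc1.trans_le (hcle _)).ne']
      simp
    have h3 := hcle (φ N)
    have h4 := norm_nonneg (T (h (φ (N + 1))) - T (h (φ N)))
    nlinarith [sq_nonneg (lam (φ (N + 1)))]
  refine ⟨lam, h, hnn, hanti, hon, hzero, fun f => ?_⟩
  have hsummable : Summable (fun k => ((lam k : ℂ) * inner ℂ (h k) f) • h k) := by
    have h1 : Summable (fun k : {k : ℕ // lam k ≠ 0} =>
        ((lam k : ℂ) * inner ℂ (h k) f) • h k) := by
      have h2 := hon.orthogonalFamily.summable_iff_norm_sq_summable
        (fun k : {k : ℕ // lam k ≠ 0} => (lam k : ℂ) * inner ℂ (h k) f)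
      simp only [LinearIsometry.toSpanSingleton_apply] at h2
      rw [h2]
      refine Summable.of_nonneg_of_le (fun _ => sq_nonneg _) (fun k => ?_)
        ((hon.inner_products_summable (x := f)).mul_left (lam 0 ^ 2))
      rw [norm_mul, mul_pow, Complex.norm_real, Real.norm_of_nonneg (hnn _)]
      gcongr
      exact hanti (Nat.zero_le _)
    refine (Subtype.val_injective.summable_iff fun k hk => ?_).1 h1
    have : lam k = 0 := by
      by_contra h'
      exact hk ⟨⟨k, h'⟩, rfl⟩
    simp [this]
  rw [hsummable.hasSum_iff_tendsto_nat]
  have hrem : Tendsto (fun n => (S n).1 f) atTop (𝓝 0) := by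
    refine squeeze_zero_norm (fun n => (S n).1.le_opNorm f) ?_
    simpa using hlim.mul_const ‖f‖
  have := (tendsto_const_nhds (x := T f)).sub hrem
  rw [sub_zero] at this
  refine this.congr fun n => ?_
  rw [hsum n f]
  abel

end Spectral

/-! ### Time-frequency shifts -/

section TimeFrequency

variable {d : ℕ}

theorem tfShift_coeFn (z : Phase d) (g : L2 d) :
    tfShift z g =ᵐ[volume] fun t : Rn d =>
      g (t - z.1) * Complex.exp (2 * Real.pi * Complex.I * (inner ℝ z.2 t : ℝ)) :=
  MemLp.coeFn_toLp _

theorem norm_exp_two_pi_I (x : ℝ) : ‖Complex.exp (2 * Real.pi * Complex.I * x)‖ = 1 := by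
  rw [show (2 * Real.pi * Complex.I * x : ℂ) = ((2 * Real.pi * x : ℝ) : ℂ) * Complex.I by
    push_cast; ring]
  exact Complex.norm_exp_ofReal_mul_I _

theorem conj_exp_two_pi_I (x : ℝ) :
    (starRingEnd ℂ) (Complex.exp (2 * Real.pi * Complex.I * x))
      = Complex.exp (-(2 * Real.pi * Complex.I * x)) := by
  rw [← Complex.exp_conj]
  simp [map_ofNat]

/-- The short-time Fourier transform is the matrix coefficient `⟨π(z)g, f⟩` (in Mathlib's
convention, conjugate linear in the first variable). -/
theorem inner_tfShift (z : Phase d) (g f : L2 d) : inner ℂ (tfShift z g) f = stft g f z := by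
  rw [L2.inner_def, stft]
  refine integral_congr_ae ?_
  filter_upwards [tfShift_coeFn z g] with t ht
  rw [RCLike.inner_apply, ht, map_mul, conj_exp_two_pi_I]
  ring

theorem norm_tfShift (z : Phase d) (g : L2 d) : ‖tfShift z g‖ = ‖g‖ := by
  rw [tfShift, Lp.norm_toLp, Lp.norm_def]
  congr 1
  have h1 : eLpNorm (fun t : Rn d =>
      g (t - z.1) * Complex.exp (2 * Real.pi * Complex.I * (inner ℝ z.2 t : ℝ))) 2 volume
      = eLpNorm (fun t : Rn d => g (t - z.1)) 2 volume :=
    eLpNorm_congr_norm_ae (Eventually.of_forall fun t => by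
      rw [norm_mul, norm_exp_two_pi_I, mul_one])
  rw [h1]
  exact eLpNorm_comp_measurePreserving (Lp.memLp g).1 (measurePreserving_sub_right volume z.1)

theorem norm_sq_eq_integral (u : L2 d) : ‖u‖ ^ 2 = ∫ t, ‖u t‖ ^ 2 := by
  have h : inner ℂ u u = ((∫ t, ‖u t‖ ^ 2 : ℝ) : ℂ) := by
    rw [L2.inner_def, ← integral_complex_ofReal]
    refine integral_congr_ae (Eventually.of_forall fun t => ?_)
    simp [inner_self_eq_norm_sq_to_K]
  rw [inner_self_eq_norm_sq_to_K] at h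
  exact Complex.ofReal_injective (by rw [← h]; simp)

theorem tfShift_sub (z : Phase d) (g g' : L2 d) :
    tfShift z (g - g') = tfShift z g - tfShift z g' := by
  refine Lp.ext ?_
  have hq := (measurePreserving_sub_right (volume : Measure (Rn d)) z.1).quasiMeasurePreserving
  filter_upwards [tfShift_coeFn z (g - g'), tfShift_coeFn z g, tfShift_coeFn z g',
    Lp.coeFn_sub (tfShift z g) (tfShift z g'), hq.ae (Lp.coeFn_sub g g')] with t h1 h2 h3 h4 h5
  rw [h1, h4, Pi.sub_apply, h2, h3, h5, Pi.sub_apply, sub_mul]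

/-- Composition law of time-frequency shifts, in terms of matrix coefficients: up to a phase,
`⟨π(w)g, π(z)g⟩` depends only on `z - w`. -/
theorem norm_inner_tfShift_tfShift (w z : Phase d) (g : L2 d) :
    ‖inner ℂ (tfShift z g) (tfShift w g)‖ = ‖stft g g (z - w)‖ := by
  rw [← inner_tfShift, L2.inner_def, L2.inner_def]
  have h1 : ∫ t, inner ℂ (tfShift z g t) (tfShift w g t) =
      ∫ t : Rn d, inner ℂ (g (t - z.1) * Complex.exp (2 * Real.pi * Complex.I * (inner ℝ z.2 t : ℝ)))
        (g (t - w.1) * Complex.exp (2 * Real.pi * Complex.I * (inner ℝ w.2 t : ℝ))) := by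
    refine integral_congr_ae ?_
    filter_upwards [tfShift_coeFn z g, tfShift_coeFn w g] with t ht ht'
    rw [ht, ht']
  have h2 : ∫ t, inner ℂ (tfShift (z - w) g t) (g t) =
      ∫ t : Rn d, inner ℂ (g (t - (z - w).1) *
        Complex.exp (2 * Real.pi * Complex.I * (inner ℝ (z - w).2 t : ℝ))) (g t) := by
    refine integral_congr_ae ?_
    filter_upwards [tfShift_coeFn (z - w) g] with t ht
    rw [ht]
  rw [h1, h2, ← integral_add_right_eq_self _ w.1]
  have h3 : ∀ t : Rn d, inner ℂ
      (g (t + w.1 - z.1) * Complex.exp (2 * Real.pi * Complex.I * (inner ℝ z.2 (t + w.1) : ℝ)))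
      (g (t + w.1 - w.1) * Complex.exp (2 * Real.pi * Complex.I * (inner ℝ w.2 (t + w.1) : ℝ)))
      = Complex.exp (2 * Real.pi * Complex.I * ((inner ℝ (w.2 - z.2) w.1 : ℝ))) *
        inner ℂ (g (t - (z - w).1) *
          Complex.exp (2 * Real.pi * Complex.I * (inner ℝ (z - w).2 t : ℝ))) (g t) := by
    intro t
    rw [RCLike.inner_apply, RCLike.inner_apply, add_sub_cancel_right, Prod.fst_sub, Prod.snd_sub,
      show t + w.1 - z.1 = t - (z.1 - w.1) by abel, map_mul, map_mul, conj_exp_two_pi_I,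
      conj_exp_two_pi_I]
    have h4 : Complex.exp (2 * Real.pi * Complex.I * (inner ℝ w.2 (t + w.1) : ℝ)) *
        Complex.exp (-(2 * Real.pi * Complex.I * (inner ℝ z.2 (t + w.1) : ℝ))) =
        Complex.exp (2 * Real.pi * Complex.I * ((inner ℝ (w.2 - z.2) w.1 : ℝ))) *
        Complex.exp (-(2 * Real.pi * Complex.I * (inner ℝ (z.2 - w.2) t : ℝ))) := by
      rw [← Complex.exp_add, ← Complex.exp_add]
      congr 1
      simp only [inner_add_right, inner_sub_left]
      push_cast
      ring
    linear_combination (g t * (starRingEnd ℂ) (g (t - (z.1 - w.1)))) * h4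
  simp_rw [h3]
  rw [integral_const_mul, norm_mul, norm_exp_two_pi_I, one_mul]

/-- Translations act continuously on `L²`. -/
theorem continuous_translation (g : L2 d) :
    Continuous fun x : Rn d => (Lp.compMeasurePreserving (fun t : Rn d => t - x)
      (measurePreserving_sub_right volume x) g : L2 d) := by
  let G : C(Rn d, C(Rn d, Rn d)) :=
    (ContinuousMap.mk (fun a : Rn d × Rn d => a.2 - a.1) (by fun_prop)).curry
  exact continuous_const.compMeasurePreservingLp G.continuous _ ENNReal.ofNat_ne_top

/-- Time-frequency shifts act strongly continuously on `L²`. -/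
theorem continuous_tfShift (g : L2 d) : Continuous fun z : Phase d => tfShift z g := by
  rw [continuous_iff_continuousAt]
  intro z₀
  let T : Rn d → L2 d := fun x => Lp.compMeasurePreserving (fun t : Rn d => t - x)
      (measurePreserving_sub_right volume x) g
  have hT : ∀ x, T x =ᵐ[volume] fun t : Rn d => g (t - x) := fun x =>
    Lp.coeFn_compMeasurePreserving _ _
  have hTz : ∀ z : Phase d, tfShift z g = tfShift (0, z.2) (T z.1) := by
    intro z
    refine Lp.ext ?_
    filter_upwards [tfShift_coeFn z g, tfShift_coeFn (0, z.2) (T z.1), hT z.1] with t h1 h2 h3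
    rw [h1, h2]
    simp only [sub_zero, h3]
  -- The modulations alone, by dominated convergence.
  have hmod : Tendsto (fun z : Phase d => ‖tfShift (0, z.2) (T z₀.1) - tfShift (0, z₀.2) (T z₀.1)‖)
      (𝓝 z₀) (𝓝 0) := by
    set u := T z₀.1 with hu
    have hsq : ∀ z : Phase d, ‖tfShift (0, z.2) u - tfShift (0, z₀.2) u‖ ^ 2 =
        ∫ t : Rn d, (‖u t‖ * ‖Complex.exp (2 * Real.pi * Complex.I * (inner ℝ z.2 t : ℝ)) -
          Complex.exp (2 * Real.pi * Complex.I * (inner ℝ z₀.2 t : ℝ))‖) ^ 2 := by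
      intro z
      rw [norm_sq_eq_integral]
      refine integral_congr_ae ?_
      filter_upwards [Lp.coeFn_sub (tfShift (0, z.2) u) (tfShift (0, z₀.2) u),
        tfShift_coeFn (0, z.2) u, tfShift_coeFn (0, z₀.2) u] with t h1 h2 h3
      rw [h1, Pi.sub_apply, h2, h3]
      simp only [sub_zero]
      rw [← mul_sub, norm_mul]
    have hlim : Tendsto (fun z : Phase d => ‖tfShift (0, z.2) u - tfShift (0, z₀.2) u‖ ^ 2)
        (𝓝 z₀) (𝓝 (∫ t : Rn d, (0 : ℝ))) := by
      simp_rw [hsq]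
      refine tendsto_integral_filter_of_dominated_convergence (fun t => 4 * ‖u t‖ ^ 2)
        (Eventually.of_forall fun z => ?_) (Eventually.of_forall fun z =>
          Eventually.of_forall fun t => ?_) ?_ (Eventually.of_forall fun t => ?_)
      · have : Continuous fun t : Rn d =>
            ‖Complex.exp (2 * Real.pi * Complex.I * (inner ℝ z.2 t : ℝ)) -
              Complex.exp (2 * Real.pi * Complex.I * (inner ℝ z₀.2 t : ℝ))‖ := by fun_prop
        exact ((Lp.aestronglyMeasurable u).norm.mul this.aestronglyMeasurable).pow 2
      · rw [Real.norm_of_nonneg (sq_nonneg _), mul_pow, mul_comm]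
        have h5 : ‖Complex.exp (2 * Real.pi * Complex.I * (inner ℝ z.2 t : ℝ)) -
              Complex.exp (2 * Real.pi * Complex.I * (inner ℝ z₀.2 t : ℝ))‖ ≤ 2 := by
          refine (norm_sub_le _ _).trans ?_
          rw [norm_exp_two_pi_I, norm_exp_two_pi_I]
          norm_num
        gcongr
        nlinarith [norm_nonneg (Complex.exp (2 * Real.pi * Complex.I * (inner ℝ z.2 t : ℝ)) -
              Complex.exp (2 * Real.pi * Complex.I * (inner ℝ z₀.2 t : ℝ)))]
      · exact ((Lp.memLp u).integrable_norm_pow (by norm_num)).const_mul 4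
      · have : Continuous fun z : Phase d => (‖u t‖ *
            ‖Complex.exp (2 * Real.pi * Complex.I * (inner ℝ z.2 t : ℝ)) -
              Complex.exp (2 * Real.pi * Complex.I * (inner ℝ z₀.2 t : ℝ))‖) ^ 2 := by fun_prop
        have h6 := this.tendsto z₀
        simpa using h6
    rw [integral_zero] at hlim
    have := (Real.continuous_sqrt.tendsto 0).comp hlim
    simpa [Function.comp_def, Real.sqrt_sq (norm_nonneg _)] using this
  have htr : Tendsto (fun z : Phase d => ‖T z.1 - T z₀.1‖) (𝓝 z₀) (𝓝 0) := by
    have h7 : Continuous fun z : Phase d => ‖T z.1 - T z₀.1‖ :=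
      (((continuous_translation g).comp continuous_fst).sub continuous_const).norm
    simpa using h7.tendsto z₀
  rw [ContinuousAt, tendsto_iff_norm_sub_tendsto_zero]
  refine squeeze_zero (fun _ => norm_nonneg _) (fun z => ?_) (by simpa using htr.add hmod)
  rw [hTz z, hTz z₀]
  calc ‖tfShift (0, z.2) (T z.1) - tfShift (0, z₀.2) (T z₀.1)‖
      = ‖tfShift (0, z.2) (T z.1 - T z₀.1) +
          (tfShift (0, z.2) (T z₀.1) - tfShift (0, z₀.2) (T z₀.1))‖ := by
        rw [tfShift_sub]; congr 1; abel
    _ ≤ _ := (norm_add_le _ _).trans_eq (by rw [norm_tfShift])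

theorem continuous_stft (g f : L2 d) : Continuous (stft g f) := by
  have : stft g f = fun z => inner ℂ (tfShift z g) f := funext fun z => (inner_tfShift z g f).symm
  rw [this]
  exact (continuous_tfShift g).inner continuous_const

end TimeFrequency

/-! ### Plancherel's theorem and Moyal's identity -/

section Plancherel

open scoped FourierTransform ENNReal

/-- The `L²` Fourier transform of an integrable and square integrable function is given by the
Fourier integral. -/
theorem fourier_toLp_ae_eq {V : Type*} [NormedAddCommGroup V] [InnerProductSpace ℝ V]
    [FiniteDimensional ℝ V] [MeasurableSpace V] [BorelSpace V] {u : V → ℂ}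
    (h1 : Integrable u) (h2 : MemLp u 2) :
    (𝓕 (h2.toLp u) : Lp ℂ 2 (volume : Measure V)) =ᵐ[volume] 𝓕 u := by
  refine ae_eq_of_integral_contDiff_smul_eq ?_ ?_ fun φ hφ hφc => ?_
  · exact (Lp.memLp _).locallyIntegrable (by norm_num)
  · have : Continuous (𝓕 u) := VectorFourier.fourierIntegral_continuous
      Real.continuous_fourierChar (by exact continuous_inner) h1
    exact this.locallyIntegrable
  · have hφ' : ContDiff ℝ ((⊤ : ℕ∞) : WithTop ℕ∞) (fun x => (φ x : ℂ)) := Complex.ofRealCLM.contDiff.comp hφ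
    have hφc' : HasCompactSupport (fun x => (φ x : ℂ)) :=
      hφc.comp_left (g := fun r : ℝ => (r : ℂ)) Complex.ofReal_zero
    -- On test functions both sides agree: the Fourier transform can be moved onto `ψ`, on the left
    -- for tempered distributions and on the right by Fubini.
    let ψ : SchwartzMap V ℂ := hφc'.toSchwartzMap hφ'
    have hψ : ∀ x, ψ x = (φ x : ℂ) := fun x => rfl
    have h3 := DFunLike.congr_fun (Lp.fourier_toTemperedDistribution_eq (h2.toLp u)) ψ
    rw [TemperedDistribution.fourier_apply, Lp.toTemperedDistribution_apply,
      Lp.toTemperedDistribution_apply] at h3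
    have h4 := VectorFourier.integral_fourierIntegral_smul_eq_flip (μ := volume) (ν := volume)
      (e := Real.fourierChar) (L := innerₗ V) Real.continuous_fourierChar
      (by exact continuous_inner) ψ.integrable h1
    have h5 : ∫ x, φ x • (𝓕 (h2.toLp u) : Lp ℂ 2 (volume : Measure V)) x
        = ∫ x, ψ x • (𝓕 (h2.toLp u) : Lp ℂ 2 (volume : Measure V)) x := by
      simp [hψ]
    have h6 : ∫ x, φ x • 𝓕 u x = ∫ x, ψ x • 𝓕 u x := by simp [hψ]
    rw [h5, h6, ← h3]
    have h7 : ∫ x, (𝓕 ψ) x • (h2.toLp u) x = ∫ x, (𝓕 ψ) x • u x := by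
      refine integral_congr_ae ?_
      filter_upwards [h2.coeFn_toLp] with x hx
      rw [hx]
    rw [h7]
    simpa using! h4

theorem lintegral_enorm_sq_coeFn {α : Type*} [MeasurableSpace α] {μ : Measure α} (f : Lp ℂ 2 μ) :
    ∫⁻ x, ‖f x‖ₑ ^ 2 ∂μ = ‖f‖ₑ ^ 2 := by
  rw [Lp.enorm_def]
  have := eLpNorm_nnreal_pow_eq_lintegral (f := f) (μ := μ) (p := 2) (by norm_num)
  simpa using this.symm

/-- **Plancherel's theorem** for the Fourier integral of a function in `L¹ ∩ L²`. -/
theorem lintegral_enorm_sq_fourier {V : Type*} [NormedAddCommGroup V] [InnerProductSpace ℝ V]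
    [FiniteDimensional ℝ V] [MeasurableSpace V] [BorelSpace V] {u : V → ℂ}
    (h1 : Integrable u) (h2 : MemLp u 2) :
    ∫⁻ ξ, ‖𝓕 u ξ‖ₑ ^ 2 = ∫⁻ x, ‖u x‖ₑ ^ 2 := by
  have h3 : ∫⁻ ξ, ‖(𝓕 (h2.toLp u) : Lp ℂ 2 (volume : Measure V)) ξ‖ₑ ^ 2 =
      ∫⁻ x, ‖h2.toLp u x‖ₑ ^ 2 := by
    rw [lintegral_enorm_sq_coeFn, lintegral_enorm_sq_coeFn, ← ofReal_norm, Lp.norm_fourier_eq,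
      ofReal_norm]
  calc ∫⁻ ξ, ‖𝓕 u ξ‖ₑ ^ 2 = _ :=
        lintegral_congr_ae ((fourier_toLp_ae_eq h1 h2).symm.fun_comp fun y => ‖y‖ₑ ^ 2)
    _ = _ := h3
    _ = _ := lintegral_congr_ae (h2.coeFn_toLp.fun_comp fun y => ‖y‖ₑ ^ 2)

theorem stft_eq_fourier {d : ℕ} (g f : L2 d) (x ξ : Rn d) :
    stft g f (x, ξ) = 𝓕 (fun t : Rn d => f t * (starRingEnd ℂ) (g (t - x))) ξ := by
  rw [stft, Real.fourier_eq]
  refine integral_congr_ae (Eventually.of_forall fun t => ?_)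
  simp only [Circle.smul_def, Real.fourierChar_apply, smul_eq_mul]
  rw [mul_comm, real_inner_comm]
  congr 2
  push_cast
  ring

/-- **Moyal's identity**: the short-time Fourier transform preserves `L²` norms. -/
theorem lintegral_enorm_sq_stft {d : ℕ} (g f : L2 d) :
    ∫⁻ z, ‖stft g f z‖ₑ ^ 2 = ‖f‖ₑ ^ 2 * ‖g‖ₑ ^ 2 := by
  have hfm : AEMeasurable (fun t : Rn d => ‖f t‖ₑ ^ 2) :=
    (Lp.aestronglyMeasurable f).enorm.pow_const 2
  have hgm : AEMeasurable (fun t : Rn d => ‖g t‖ₑ ^ 2) :=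
    (Lp.aestronglyMeasurable g).enorm.pow_const 2
  have hmeas : AEMeasurable (fun p : Rn d × Rn d => ‖f p.2‖ₑ ^ 2 * ‖g (p.2 - p.1)‖ₑ ^ 2)
      ((volume : Measure (Rn d)).prod volume) := by
    refine (hfm.comp_quasiMeasurePreserving Measure.quasiMeasurePreserving_snd).mul ?_
    have h0 : Measure.QuasiMeasurePreserving (fun p : Rn d × Rn d => p.2 - p.1)
        ((volume : Measure (Rn d)).prod volume) volume := by
      have := (quasiMeasurePreserving_sub_of_right_invariant (volume : Measure (Rn d)) volume).comp
        (Measure.measurePreserving_swap (μ := (volume : Measure (Rn d)))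
          (ν := (volume : Measure (Rn d)))).quasiMeasurePreserving
      exact this
    exact hgm.comp_quasiMeasurePreserving h0
  have hdouble : ∫⁻ x : Rn d, ∫⁻ t : Rn d, ‖f t‖ₑ ^ 2 * ‖g (t - x)‖ₑ ^ 2
      = ‖f‖ₑ ^ 2 * ‖g‖ₑ ^ 2 := by
    rw [lintegral_lintegral_swap hmeas]
    have h1 : ∀ t : Rn d, ∫⁻ x : Rn d, ‖f t‖ₑ ^ 2 * ‖g (t - x)‖ₑ ^ 2 = ‖f t‖ₑ ^ 2 * ‖g‖ₑ ^ 2 := by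
      intro t
      rw [lintegral_const_mul' _ _ (by simp), lintegral_sub_left_eq_self (fun y => ‖g y‖ₑ ^ 2) t,
        lintegral_enorm_sq_coeFn]
    simp_rw [h1]
    rw [lintegral_mul_const' _ _ (by simp), lintegral_enorm_sq_coeFn]
  have hslice : ∀ᵐ x : Rn d, ∫⁻ ξ : Rn d, ‖stft g f (x, ξ)‖ₑ ^ 2
      = ∫⁻ t : Rn d, ‖f t‖ₑ ^ 2 * ‖g (t - x)‖ₑ ^ 2 := by
    -- Plancherel applies to almost every slice, because `f · conj g(· - x)` is in `L¹` for all `x`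
    -- and in `L²` for almost all `x`.
    have hfin : ∀ᵐ x : Rn d, ∫⁻ t : Rn d, ‖f t‖ₑ ^ 2 * ‖g (t - x)‖ₑ ^ 2 < ∞ := by
      refine ae_lt_top' hmeas.lintegral_prod_right' ?_
      rw [hdouble]
      exact ENNReal.mul_ne_top (by simp) (by simp)
    filter_upwards [hfin] with x hx
    have hgx : MemLp (fun t : Rn d => (starRingEnd ℂ) (g (t - x))) 2 :=
      ((Lp.memLp g).comp_measurePreserving (measurePreserving_sub_right volume x)).star
    have hen : ∀ t : Rn d, ‖f t * (starRingEnd ℂ) (g (t - x))‖ₑ ^ 2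
        = ‖f t‖ₑ ^ 2 * ‖g (t - x)‖ₑ ^ 2 := fun t => by
      rw [enorm_mul, mul_pow, RCLike.enorm_conj]
    have hint : Integrable (fun t : Rn d => f t * (starRingEnd ℂ) (g (t - x))) :=
      (Lp.memLp f).integrable_mul hgx
    have hL2 : MemLp (fun t : Rn d => f t * (starRingEnd ℂ) (g (t - x))) 2 := by
      refine ⟨hint.1, ?_⟩
      have h3 := eLpNorm_nnreal_pow_eq_lintegral
        (f := fun t : Rn d => f t * (starRingEnd ℂ) (g (t - x))) (μ := volume) (p := 2) (by norm_num)
      have h4 : eLpNorm (fun t : Rn d => f t * (starRingEnd ℂ) (g (t - x))) 2 volume ^ 2 < ∞ := by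
        have h5 : eLpNorm (fun t : Rn d => f t * (starRingEnd ℂ) (g (t - x))) 2 volume ^ 2
            = ∫⁻ t : Rn d, ‖f t‖ₑ ^ 2 * ‖g (t - x)‖ₑ ^ 2 := by
          simp_rw [← hen]
          simpa using h3
        rw [h5]
        exact hx
      simpa [ENNReal.pow_lt_top_iff] using h4
    simp_rw [stft_eq_fourier]
    rw [lintegral_enorm_sq_fourier hint hL2]
    simp_rw [hen]
  have hc : Measurable fun z : Phase d => ‖stft g f z‖ₑ ^ 2 :=
    (continuous_stft g f).measurable.enorm.pow_const 2
  rw [Measure.volume_eq_prod, lintegral_prod _ hc.aemeasurable, lintegral_congr_ae hslice, hdouble]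

end Plancherel

/-! ### Localization operators and their eigensystems -/

section LocalizationOperator

open InnerProductSpace

variable {d : ℕ}

theorem continuous_rankOne_tfShift (g : L2 d) :
    Continuous fun z : Phase d => rankOne ℂ (tfShift z g) (tfShift z g) := by
  have hc := continuous_tfShift g
  have h1 : Continuous fun z : Phase d => innerSL ℂ (tfShift z g) :=
    (innerSL ℂ (E := L2 d)).continuous.comp hc
  exact ((ContinuousLinearMap.smulRightL ℂ (L2 d) (L2 d)).continuous.comp h1).clm_apply hc

theorem integrableOn_rankOne_tfShift (g : L2 d) {K : Set (Phase d)} (hK : IsCompact K) :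
    IntegrableOn (fun z : Phase d => rankOne ℂ (tfShift z g) (tfShift z g)) K :=
  (continuous_rankOne_tfShift g).continuousOn.integrableOn_compact hK

theorem integrableOn_stft_smul_tfShift (g f : L2 d) {K : Set (Phase d)} (hK : IsCompact K) :
    IntegrableOn (fun z : Phase d => stft g f z • tfShift z g) K :=
  ((continuous_stft g f).smul (continuous_tfShift g)).continuousOn.integrableOn_compact hK

/-- The localization operator as a bounded operator: the norm convergent integral of the rank one
operators `f ↦ ⟨π(z)g, f⟩ π(z)g` over `K`. -/
noncomputable def locCLM (g : L2 d) (K : Set (Phase d)) : L2 d →L[ℂ] L2 d :=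
  ∫ z in K, rankOne ℂ (tfShift z g) (tfShift z g)

theorem locCLM_apply (g : L2 d) {K : Set (Phase d)} (hK : IsCompact K) (f : L2 d) :
    locCLM g K f = locOp g K f := by
  rw [locCLM, ContinuousLinearMap.integral_apply (integrableOn_rankOne_tfShift g hK), locOp]
  simp only [rankOne_apply, inner_tfShift]

theorem inner_locOp_self (g : L2 d) {K : Set (Phase d)} (hK : IsCompact K) (f : L2 d) :
    inner ℂ f (locOp g K f) = ((∫ z in K, ‖stft g f z‖ ^ 2 : ℝ) : ℂ) := by
  rw [locOp, ← integral_inner (integrableOn_stft_smul_tfShift g f hK), ← integral_complex_ofReal]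
  refine integral_congr_ae (Eventually.of_forall fun z => ?_)
  simp only
  rw [inner_smul_right, ← inner_conj_symm, inner_tfShift, Complex.mul_conj, Complex.normSq_eq_norm_sq]

theorem isPositive_locCLM (g : L2 d) {K : Set (Phase d)} (hK : IsCompact K) :
    (locCLM g K).IsPositive := by
  rw [ContinuousLinearMap.isPositive_iff_complex]
  intro f
  rw [locCLM_apply g hK, ← inner_conj_symm, inner_locOp_self g hK, Complex.conj_ofReal]
  exact ⟨by simp, by simpa using integral_nonneg fun z => sq_nonneg ‖stft g f z‖⟩

theorem isCompactOperator_locCLM (g : L2 d) {K : Set (Phase d)} (hK : IsCompact K) :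
    IsCompactOperator (locCLM g K) := by
  let C : Submodule ℂ (L2 d →L[ℂ] L2 d) := compactOperator (RingHom.id ℂ) (L2 d) (L2 d)
  have hclosed : IsClosed (C : Set (L2 d →L[ℂ] L2 d)) := isClosed_setOfPred_isCompactOperator
  have hmem : ∀ z : Phase d, rankOne ℂ (tfShift z g) (tfShift z g) ∈ C := fun z => by
    change IsCompactOperator (rankOne ℂ (tfShift z g) (tfShift z g))
    rw [rankOne_def']
    exact (isCompactOperator_of_locallyCompactSpace_rng
      (ContinuousLinearMap.toSpanSingleton ℂ (tfShift z g))).comp_clm _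
  change locCLM g K ∈ C
  -- The compact operators form a closed convex set, which contains the averages of its members.
  rcases eq_or_ne (volume K) 0 with h0 | h0
  · rw [locCLM, setIntegral_measure_zero _ h0]
    exact C.zero_mem
  have hconv : Convex ℝ (C : Set (L2 d →L[ℂ] L2 d)) := (C.restrictScalars ℝ).convex
  have hav := hconv.set_average_mem hclosed h0 hK.measure_lt_top.ne
    (Eventually.of_forall hmem) (integrableOn_rankOne_tfShift g hK)
  rw [setAverage_eq] at hav
  have h1 : (volume.real K) • ((volume.real K)⁻¹ • locCLM g K) ∈ C.restrictScalars ℝ :=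
    (C.restrictScalars ℝ).smul_mem _ hav
  have h2 : volume.real K ≠ 0 := by
    rw [Measure.real, ENNReal.toReal_ne_zero]
    exact ⟨h0, hK.measure_lt_top.ne⟩
  rwa [smul_smul, mul_inv_cancel₀ h2, one_smul] at h1

theorem exists_isEigensystem (g : L2 d) {K : Set (Phase d)} (hK : IsCompact K) :
    ∃ (lam : ℕ → ℝ) (h : ℕ → L2 d), IsEigensystem g K lam h := by
  obtain ⟨lam, h, h1, h2, h3, h4, h5⟩ :=
    exists_ordered_diagonalization (isCompactOperator_locCLM g hK) (isPositive_locCLM g hK)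
  exact ⟨lam, h, h1, h2, h3, h4, fun f => by rw [← locCLM_apply g hK]; exact h5 f⟩

end LocalizationOperator

section Spectrogram

open scoped ENNReal

variable {d : ℕ}

instance isAddHaarMeasure_volume_phase : (volume : Measure (Phase d)).IsAddHaarMeasure :=
  inferInstanceAs ((volume : Measure (Rn d)).prod (volume : Measure (Rn d))).IsAddHaarMeasure

instance isNegInvariant_volume_phase : (volume : Measure (Phase d)).IsNegInvariant :=
  Measure.IsAddHaarMeasure.isNegInvariant_of_regular volume

/-- The smoothed indicator function `1_K * |V_g g|²`. It is the sum `∑ λ_k |V_g h_k|²` for every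
eigensystem of the localization operator with symbol `K`. -/
noncomputable def smoothedIndicator (g : L2 d) (K : Set (Phase d)) (z : Phase d) : ℝ≥0∞ :=
  ∫⁻ w in K, ‖stft g g (z - w)‖ₑ ^ 2

theorem measurable_enorm_sq_stft (g f : L2 d) : Measurable fun z => ‖stft g f z‖ₑ ^ 2 :=
  (continuous_stft g f).measurable.enorm.pow_const 2

theorem lintegral_enorm_sq_stft_self {g : L2 d} (hg : ‖g‖ = 1) :
    ∫⁻ z, ‖stft g g z‖ₑ ^ 2 = 1 := by
  have : ‖g‖ₑ = 1 := by rw [← ofReal_norm, hg, ENNReal.ofReal_one]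
  rw [lintegral_enorm_sq_stft, this]
  simp

theorem smoothedIndicator_le_one {g : L2 d} (hg : ‖g‖ = 1) (K : Set (Phase d)) (z : Phase d) :
    smoothedIndicator g K z ≤ 1 := by
  rw [← lintegral_enorm_sq_stft_self hg,
    ← lintegral_sub_left_eq_self (fun u => ‖stft g g u‖ₑ ^ 2) z]
  exact setLIntegral_le_lintegral _ _

theorem measurable_stft_sub (g : L2 d) :
    Measurable fun p : Phase d × Phase d => ‖stft g g (p.1 - p.2)‖ₑ ^ 2 :=
  (measurable_enorm_sq_stft g g).comp (measurable_fst.sub measurable_snd)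

theorem measurable_smoothedIndicator (g : L2 d) (K : Set (Phase d)) :
    Measurable (smoothedIndicator g K) :=
  (measurable_stft_sub g).lintegral_prod_right'

theorem lintegral_smoothedIndicator {g : L2 d} (hg : ‖g‖ = 1) (K : Set (Phase d)) :
    ∫⁻ z, smoothedIndicator g K z = volume K := by
  unfold smoothedIndicator
  rw [lintegral_lintegral_swap (measurable_stft_sub g).aemeasurable]
  have h1 : ∀ w : Phase d, ∫⁻ z, ‖stft g g (z - w)‖ₑ ^ 2 = 1 := fun w => by
    rw [lintegral_sub_right_eq_self (fun u => ‖stft g g u‖ₑ ^ 2) w, lintegral_enorm_sq_stft_self hg]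
  simp [h1]

/-- The mass that `1_K * |V_g g|²` loses to the complement of `K`. -/
noncomputable def leakage (g : L2 d) (K : Set (Phase d)) : ℝ≥0∞ :=
  ∫⁻ z in Kᶜ, smoothedIndicator g K z

theorem leakage_le {g : L2 d} (hg : ‖g‖ = 1) (K : Set (Phase d)) : leakage g K ≤ volume K :=
  (setLIntegral_le_lintegral _ _).trans_eq (lintegral_smoothedIndicator hg K)

/-- What `1_K * |V_g g|²` misses inside `K` equals what it leaks outside of `K`. -/
theorem setLIntegral_one_sub_smoothedIndicator {g : L2 d} (hg : ‖g‖ = 1) {K : Set (Phase d)}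
    (hK : IsCompact K) : ∫⁻ z in K, (1 - smoothedIndicator g K z) = leakage g K := by
  have hfin : ∫⁻ z in K, smoothedIndicator g K z ≠ ∞ :=
    ((setLIntegral_le_lintegral _ _).trans_lt
      ((lintegral_smoothedIndicator hg K).trans_lt hK.measure_lt_top)).ne
  rw [lintegral_sub (measurable_smoothedIndicator g K) hfin
    (Eventually.of_forall fun z => smoothedIndicator_le_one hg K z), setLIntegral_one]
  have h1 := lintegral_add_compl (smoothedIndicator g K) hK.measurableSet (μ := volume)
  rw [lintegral_smoothedIndicator hg] at h1
  rw [← h1]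
  exact ENNReal.add_sub_cancel_left hfin

end Spectrogram

namespace IsEigensystem

open scoped ENNReal

variable {d : ℕ} {g : L2 d} {K : Set (Phase d)} {lam : ℕ → ℝ} {h : ℕ → L2 d}

/-- The expansion `∑ λ_k |V_g h_k(z)|² = ⟨L_K π(z)g, π(z)g⟩ = (1_K * |V_g g|²)(z)`. -/
theorem hasSum_mul_norm_sq_stft (hE : IsEigensystem g K lam h) (hK : IsCompact K) (z : Phase d) :
    HasSum (fun k => lam k * ‖stft g (h k) z‖ ^ 2) (∫ w in K, ‖stft g g (z - w)‖ ^ 2) := by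
  have h1 := (innerSL ℂ (tfShift z g)).hasSum (hE.diag (tfShift z g))
  simp only [innerSL_apply_apply] at h1
  rw [inner_locOp_self g hK] at h1
  have h2 : ∀ w : Phase d, ‖stft g (tfShift z g) w‖ = ‖stft g g (z - w)‖ := fun w => by
    rw [← inner_tfShift, norm_inner_symm, norm_inner_tfShift_tfShift]
  simp only [h2] at h1
  refine (Complex.hasSum_ofReal (L := .unconditional ℕ)).1 ?_
  convert! h1 using 1
  funext k
  rw [inner_smul_right, ← inner_conj_symm (h k), inner_tfShift, mul_assoc, mul_comm (starRingEnd ℂ _),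
    Complex.mul_conj, Complex.normSq_eq_norm_sq]
  push_cast
  ring

theorem tsum_mul_enorm_sq_stft (hE : IsEigensystem g K lam h) (hK : IsCompact K) (z : Phase d) :
    ∑' k, ENNReal.ofReal (lam k) * ‖stft g (h k) z‖ₑ ^ 2 = smoothedIndicator g K z := by
  have h1 := hE.hasSum_mul_norm_sq_stft hK z
  have h2 : ∀ k, ENNReal.ofReal (lam k) * ‖stft g (h k) z‖ₑ ^ 2
      = ENNReal.ofReal (lam k * ‖stft g (h k) z‖ ^ 2) := fun k => by
    rw [ENNReal.ofReal_mul (hE.nonneg k), ENNReal.ofReal_pow (norm_nonneg _), ofReal_norm]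
  simp_rw [h2]
  rw [← ENNReal.ofReal_tsum_of_nonneg (fun k => mul_nonneg (hE.nonneg k) (sq_nonneg _)) h1.summable,
    h1.tsum_eq, ofReal_integral_eq_lintegral_ofReal]
  · simp_rw [ENNReal.ofReal_pow (norm_nonneg _), ofReal_norm]
    rfl
  · have : Continuous fun w : Phase d => ‖stft g g (z - w)‖ ^ 2 :=
      ((continuous_stft g g).comp (continuous_const.sub continuous_id)).norm.pow 2
    exact this.continuousOn.integrableOn_compact hK
  · exact Eventually.of_forall fun w => sq_nonneg _

theorem inner_locOp (hE : IsEigensystem g K lam h) (k : ℕ) :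
    inner ℂ (h k) (locOp g K (h k)) = (lam k : ℂ) := by
  by_cases hk : lam k = 0
  · rw [hE.eq_zero k hk, hk, inner_zero_left, Complex.ofReal_zero]
  have h1 := (innerSL ℂ (h k)).hasSum (hE.diag (h k))
  simp only [innerSL_apply_apply] at h1
  refine h1.unique ?_
  have hn : ‖h k‖ = 1 := hE.orthonormal.1 ⟨k, hk⟩
  have h2 : inner ℂ (h k) (((lam k : ℂ) * inner ℂ (h k) (h k)) • h k) = (lam k : ℂ) := by
    rw [inner_smul_right, inner_self_eq_norm_sq_to_K, hn]
    simp
  have h3 := hasSum_single (f := fun b => inner ℂ (h k) (((lam b : ℂ) * inner ℂ (h b) (h k)) • h b))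
    k fun j hj => ?_
  · simpa only [h2] using h3
  · by_cases hj0 : lam j = 0
    · simp [hj0]
    · have : inner ℂ (h k) (h j) = (0 : ℂ) :=
        hE.orthonormal.2 (i := ⟨k, hk⟩) (j := ⟨j, hj0⟩) fun h' => hj (congrArg Subtype.val h').symm
      rw [inner_smul_right, this, mul_zero]

theorem setLIntegral_enorm_sq_stft (hE : IsEigensystem g K lam h) (hK : IsCompact K) (k : ℕ) :
    ∫⁻ z in K, ‖stft g (h k) z‖ₑ ^ 2 = ENNReal.ofReal (lam k) := by
  have h1 := hE.inner_locOp k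
  rw [inner_locOp_self g hK, Complex.ofReal_inj] at h1
  rw [← h1, ofReal_integral_eq_lintegral_ofReal]
  · simp_rw [ENNReal.ofReal_pow (norm_nonneg _), ofReal_norm]
  · exact ((continuous_stft g (h k)).norm.pow 2).continuousOn.integrableOn_compact hK
  · exact Eventually.of_forall fun w => sq_nonneg _

theorem lintegral_enorm_sq_stft (hE : IsEigensystem g K lam h) (hg : ‖g‖ = 1) {k : ℕ}
    (hk : lam k ≠ 0) : ∫⁻ z, ‖stft g (h k) z‖ₑ ^ 2 = 1 := by
  have h1 : ‖g‖ₑ = 1 := by rw [← ofReal_norm, hg, ENNReal.ofReal_one]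
  have h2 : ‖h k‖ₑ = 1 := by
    rw [← ofReal_norm, hE.orthonormal.1 ⟨k, hk⟩, ENNReal.ofReal_one]
  rw [_root_.lintegral_enorm_sq_stft, h1, h2]
  simp

theorem lintegral_enorm_sq_stft_le (hE : IsEigensystem g K lam h) (hg : ‖g‖ = 1) (k : ℕ) :
    ∫⁻ z, ‖stft g (h k) z‖ₑ ^ 2 ≤ 1 := by
  by_cases hk : lam k = 0
  · rw [_root_.lintegral_enorm_sq_stft, hE.eq_zero k hk]
    simp
  · exact (hE.lintegral_enorm_sq_stft hg hk).le

theorem le_one (hE : IsEigensystem g K lam h) (hg : ‖g‖ = 1) (hK : IsCompact K) (k : ℕ) :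
    lam k ≤ 1 := by
  have h1 : ENNReal.ofReal (lam k) ≤ 1 := by
    rw [← hE.setLIntegral_enorm_sq_stft hK]
    exact (setLIntegral_le_lintegral _ _).trans (hE.lintegral_enorm_sq_stft_le hg k)
  simpa using h1

/-- The trace formula `∑ λ_k = |K|`. -/
theorem tsum_ofReal (hE : IsEigensystem g K lam h) (hg : ‖g‖ = 1) (hK : IsCompact K) :
    ∑' k, ENNReal.ofReal (lam k) = volume K := by
  rw [← lintegral_smoothedIndicator hg K]
  simp_rw [← hE.tsum_mul_enorm_sq_stft hK]
  rw [lintegral_tsum fun k => ((measurable_enorm_sq_stft g (h k)).const_mul _).aemeasurable]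
  congr 1
  funext k
  rw [lintegral_const_mul _ (measurable_enorm_sq_stft g (h k))]
  by_cases hk : lam k = 0
  · simp [hk]
  · rw [hE.lintegral_enorm_sq_stft hg hk, mul_one]

/-- The identity `tr (L_K - L_K²) = ∑ λ_k (1 - λ_k) = ∫_{Kᶜ} 1_K * |V_g g|²`. -/
theorem tsum_ofReal_mul_one_sub (hE : IsEigensystem g K lam h) (hg : ‖g‖ = 1) (hK : IsCompact K) :
    ∑' k, ENNReal.ofReal (lam k * (1 - lam k)) = leakage g K := by
  unfold leakage
  simp_rw [← hE.tsum_mul_enorm_sq_stft hK]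
  rw [lintegral_tsum fun k => ((measurable_enorm_sq_stft g (h k)).const_mul _).aemeasurable]
  congr 1
  funext k
  rw [lintegral_const_mul _ (measurable_enorm_sq_stft g (h k)), ENNReal.ofReal_mul (hE.nonneg k)]
  by_cases hk : lam k = 0
  · simp [hk]
  have h1 := lintegral_add_compl (fun z => ‖stft g (h k) z‖ₑ ^ 2) hK.measurableSet (μ := volume)
  rw [hE.lintegral_enorm_sq_stft hg hk, hE.setLIntegral_enorm_sq_stft hK] at h1
  rw [ENNReal.ofReal_sub _ (hE.nonneg k), ENNReal.ofReal_one, ← h1,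
    ENNReal.add_sub_cancel_left ENNReal.ofReal_ne_top]

end IsEigensystem

/-! ### The `L¹` estimate for the accumulated spectrogram -/

section AccumulatedSpectrogram

open scoped ENNReal

variable {d : ℕ} {g : L2 d} {K : Set (Phase d)} {lam : ℕ → ℝ} {h : ℕ → L2 d}

/-- If `lam` is a non-increasing sequence in `[0, 1]` with sum `V`, then the distance in `ℓ¹`
between `lam` and the indicator function of the first `A = ⌈V⌉` indices is controlled by
`∑ lam (1 - lam)`. -/
theorem sum_one_sub_add_tsum_le {V E : ℝ} (h0 : ∀ k, 0 ≤ lam k) (h1 : ∀ k, lam k ≤ 1)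
    (hanti : Antitone lam) (hV : HasSum lam V) (hE : HasSum (fun k => lam k * (1 - lam k)) E) :
    (∑ k ∈ Finset.range ⌈V⌉₊, (1 - lam k)) + ∑' k, lam (k + ⌈V⌉₊) ≤ (⌈V⌉₊ - V) + 2 * E := by
  set A := ⌈V⌉₊ with hA
  have hAV : V ≤ A := Nat.le_ceil V
  have hsplit := hV.summable.sum_add_tsum_nat_add A
  have hsplitE := hE.summable.sum_add_tsum_nat_add A
  rw [hV.tsum_eq] at hsplit
  rw [hE.tsum_eq] at hsplitE
  set t := lam A with ht
  have ht0 : 0 ≤ t := h0 A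
  -- Below `A` the eigenvalues are at least `t`, from `A` on they are at most `t`.
  have hlow : t * ∑ k ∈ Finset.range A, (1 - lam k) ≤
      ∑ k ∈ Finset.range A, lam k * (1 - lam k) := by
    rw [Finset.mul_sum]
    refine Finset.sum_le_sum fun k hk => ?_
    exact mul_le_mul_of_nonneg_right (hanti (Finset.mem_range.1 hk).le) (by linarith [h1 k])
  have hsumA : Summable fun k => lam (k + A) := (summable_nat_add_iff A).2 hV.summable
  have hhigh : (1 - t) * ∑' k, lam (k + A) ≤ ∑' k, lam (k + A) * (1 - lam (k + A)) := by
    rw [← tsum_mul_left]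
    refine Summable.tsum_le_tsum (fun k => ?_) (hsumA.mul_left _)
      ((summable_nat_add_iff A).2 hE.summable)
    rw [mul_comm]
    exact mul_le_mul_of_nonneg_left (by linarith [hanti (Nat.le_add_left A k)]) (h0 _)
  have hcard : ∑ k ∈ Finset.range A, (1 - lam k) = A - ∑ k ∈ Finset.range A, lam k := by
    simp
  rw [hcard] at hlow ⊢
  nlinarith [mul_nonneg ht0 (sub_nonneg.2 hAV)]

theorem continuous_accSpec (g : L2 d) (K : Set (Phase d)) (h : ℕ → L2 d) :
    Continuous (accSpec g K h) := by
  unfold accSpec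
  exact continuous_finsetSum _ fun k _ => (continuous_stft g (h k)).norm.pow 2

theorem integrable_accSpec (g : L2 d) (K : Set (Phase d)) (h : ℕ → L2 d) :
    Integrable (accSpec g K h) := by
  unfold accSpec
  refine integrable_finsetSum _ fun k _ => ⟨?_, ?_⟩
  · exact ((continuous_stft g (h k)).norm.pow 2).aestronglyMeasurable
  · have h1 : ∀ z, ‖‖stft g (h k) z‖ ^ 2‖ₑ = ‖stft g (h k) z‖ₑ ^ 2 := fun z => by
      rw [enorm_pow, enorm_norm]
    rw [HasFiniteIntegral]
    simp_rw [h1]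
    rw [lintegral_enorm_sq_stft]
    exact ENNReal.mul_lt_top (by simp) (by simp)

namespace IsEigensystem

/-- The pointwise comparison of the accumulated spectrogram with the indicator function of `K`, by
way of `1_K * |V_g g|² = ∑ λ_k |V_g h_k|²`. -/
theorem enorm_accSpec_sub_indicator_le (hE : IsEigensystem g K lam h) (hg : ‖g‖ = 1)
    (hK : IsCompact K) (z : Phase d) :
    ‖accSpec g K h z - K.indicator (fun _ => (1 : ℝ)) z‖ₑ ≤
      (∑ k ∈ Finset.range (ceilVol K), ENNReal.ofReal (1 - lam k) * ‖stft g (h k) z‖ₑ ^ 2) +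
      (∑' k, ENNReal.ofReal (lam (k + ceilVol K)) * ‖stft g (h (k + ceilVol K)) z‖ₑ ^ 2) +
      (K.indicator (fun z => 1 - smoothedIndicator g K z) z +
        Kᶜ.indicator (smoothedIndicator g K) z) := by
  set A := ceilVol K with hA
  set p : ℕ → ℝ := fun k => ‖stft g (h k) z‖ ^ 2 with hp
  have hp0 : ∀ k, 0 ≤ p k := fun k => sq_nonneg _
  have hpe : ∀ k, ‖stft g (h k) z‖ₑ ^ 2 = ENNReal.ofReal (p k) := fun k => by
    rw [ENNReal.ofReal_pow (norm_nonneg _), ofReal_norm]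
  have hsum := (hE.hasSum_mul_norm_sq_stft hK z).summable
  set H := ∑' k, lam k * p k with hH
  have hH0 : 0 ≤ H := tsum_nonneg fun k => mul_nonneg (hE.nonneg k) (hp0 k)
  have hsm : smoothedIndicator g K z = ENNReal.ofReal H := by
    rw [← hE.tsum_mul_enorm_sq_stft hK z, hH,
      ENNReal.ofReal_tsum_of_nonneg (fun k => mul_nonneg (hE.nonneg k) (hp0 k)) hsum]
    exact tsum_congr fun k => by rw [hpe, ENNReal.ofReal_mul (hE.nonneg k)]
  have hH1 : H ≤ 1 := by
    have := smoothedIndicator_le_one hg K z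
    rw [hsm] at this
    simpa using this
  have hsplit : accSpec g K h z - H = ∑ k ∈ Finset.range A, (1 - lam k) * p k -
      ∑' k, lam (k + A) * p (k + A) := by
    have h1 := hsum.sum_add_tsum_nat_add A
    have h2 : accSpec g K h z = ∑ k ∈ Finset.range A, p k := rfl
    rw [hH, ← h1, h2]
    simp only [sub_mul, one_mul, Finset.sum_sub_distrib]
    ring
  have hsumA : Summable fun k => lam (k + A) * p (k + A) :=
    (summable_nat_add_iff (f := fun k => lam k * p k) A).2 hsum
  have hfirst : ‖accSpec g K h z - H‖ₑ ≤
      (∑ k ∈ Finset.range A, ENNReal.ofReal (1 - lam k) * ‖stft g (h k) z‖ₑ ^ 2) +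
      (∑' k, ENNReal.ofReal (lam (k + A)) * ‖stft g (h (k + A)) z‖ₑ ^ 2) := by
    rw [hsplit]
    refine (enorm_sub_le).trans (add_le_add ?_ ?_)
    · rw [Real.enorm_of_nonneg (Finset.sum_nonneg fun k _ =>
        mul_nonneg (sub_nonneg.2 (hE.le_one hg hK k)) (hp0 k)),
        ENNReal.ofReal_sum_of_nonneg fun k _ =>
          mul_nonneg (sub_nonneg.2 (hE.le_one hg hK k)) (hp0 k)]
      exact (Finset.sum_congr rfl fun k _ => by
        rw [hpe, ENNReal.ofReal_mul (sub_nonneg.2 (hE.le_one hg hK k))]).le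
    · rw [Real.enorm_of_nonneg (tsum_nonneg fun k => mul_nonneg (hE.nonneg _) (hp0 _)),
        ENNReal.ofReal_tsum_of_nonneg (fun k => mul_nonneg (hE.nonneg _) (hp0 _))
          hsumA]
      exact (tsum_congr fun k => by rw [hpe, ENNReal.ofReal_mul (hE.nonneg _)]).le
  have hsecond : ‖H - K.indicator (fun _ => (1 : ℝ)) z‖ₑ ≤
      K.indicator (fun z => 1 - smoothedIndicator g K z) z +
        Kᶜ.indicator (smoothedIndicator g K) z := by
    by_cases hz : z ∈ K
    · have hz' : z ∉ Kᶜ := fun h' => h' hz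
      rw [Set.indicator_of_mem hz, Set.indicator_of_mem hz, Set.indicator_of_notMem hz', hsm,
        add_zero, ← ENNReal.ofReal_one, ← ENNReal.ofReal_sub _ hH0, enorm_sub_rev,
        Real.enorm_of_nonneg (by linarith)]
    · have hz' : z ∈ Kᶜ := hz
      rw [Set.indicator_of_notMem hz, Set.indicator_of_notMem hz, Set.indicator_of_mem hz', hsm,
        zero_add, sub_zero, Real.enorm_of_nonneg hH0]
  have h3 := enorm_add_le (accSpec g K h z - H) (H - K.indicator (fun _ => (1 : ℝ)) z)
  rw [sub_add_sub_cancel] at h3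
  exact h3.trans (add_le_add hfirst hsecond)

/-- The non-asymptotic `L¹` estimate for the accumulated spectrogram. -/
theorem lintegral_accSpec_sub_indicator_le (hE : IsEigensystem g K lam h) (hg : ‖g‖ = 1)
    (hK : IsCompact K) :
    ∫⁻ z, ‖accSpec g K h z - K.indicator (fun _ => (1 : ℝ)) z‖ₑ ≤
      ENNReal.ofReal (ceilVol K - (volume K).toReal) + 4 * leakage g K := by
  have hmp : ∀ k, Measurable fun z => ‖stft g (h k) z‖ₑ ^ 2 :=
    fun k => measurable_enorm_sq_stft g (h k)
  have hp1 : ∀ (c : ℝ≥0∞) k, ∫⁻ z, c * ‖stft g (h k) z‖ₑ ^ 2 ≤ c := fun c k => by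
    rw [lintegral_const_mul _ (hmp k)]
    exact mul_le_of_le_one_right' (hE.lintegral_enorm_sq_stft_le hg k)
  have hle := hE.le_one hg hK
  have hVtop : volume K ≠ ∞ := hK.measure_lt_top.ne
  have hLtop : leakage g K ≠ ∞ := ((leakage_le hg K).trans_lt hK.measure_lt_top).ne
  have hnE : ∀ k, 0 ≤ lam k * (1 - lam k) := fun k =>
    mul_nonneg (hE.nonneg k) (sub_nonneg.2 (hle k))
  have hV : HasSum lam (volume K).toReal := by
    have h1 := hE.tsum_ofReal hg hK
    have h2 := ENNReal.hasSum_toReal (f := fun k => ENNReal.ofReal (lam k)) (by rw [h1]; exact hVtop)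
    rw [← ENNReal.tsum_toReal_eq fun k => ENNReal.ofReal_ne_top, h1] at h2
    simpa only [ENNReal.toReal_ofReal (hE.nonneg _)] using h2
  have hEs : HasSum (fun k => lam k * (1 - lam k)) (leakage g K).toReal := by
    have h1 := hE.tsum_ofReal_mul_one_sub hg hK
    have h2 := ENNReal.hasSum_toReal (f := fun k => ENNReal.ofReal (lam k * (1 - lam k)))
      (by rw [h1]; exact hLtop)
    rw [← ENNReal.tsum_toReal_eq fun k => ENNReal.ofReal_ne_top, h1] at h2
    simpa only [ENNReal.toReal_ofReal (hnE _)] using h2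
  have hreal := sum_one_sub_add_tsum_le hE.nonneg hle hE.antitone hV hEs
  have hceil : ⌈(volume K).toReal⌉₊ = ceilVol K := rfl
  rw [hceil] at hreal
  have hfirst : (∑ k ∈ Finset.range (ceilVol K), ENNReal.ofReal (1 - lam k)) +
      ∑' k, ENNReal.ofReal (lam (k + ceilVol K)) ≤
      ENNReal.ofReal (ceilVol K - (volume K).toReal) + 2 * leakage g K := by
    rw [← ENNReal.ofReal_sum_of_nonneg fun k _ => sub_nonneg.2 (hle k),
      ← ENNReal.ofReal_tsum_of_nonneg (fun k => hE.nonneg _)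
        ((summable_nat_add_iff _).2 hV.summable),
      ← ENNReal.ofReal_add (Finset.sum_nonneg fun k _ => sub_nonneg.2 (hle k))
        (tsum_nonneg fun k => hE.nonneg _)]
    refine (ENNReal.ofReal_le_ofReal hreal).trans (ENNReal.ofReal_add_le.trans_eq ?_)
    rw [ENNReal.ofReal_mul (by norm_num), ENNReal.ofReal_toReal hLtop]
    norm_num
  have hsecond : ∫⁻ z, (K.indicator (fun z => 1 - smoothedIndicator g K z) z +
        Kᶜ.indicator (smoothedIndicator g K) z) = 2 * leakage g K := by
    have hm := measurable_smoothedIndicator g K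
    have hm' : Measurable fun z => 1 - smoothedIndicator g K z := measurable_const.sub hm
    rw [lintegral_add_left (hm'.indicator hK.measurableSet),
      lintegral_indicator hK.measurableSet, lintegral_indicator hK.measurableSet.compl,
      setLIntegral_one_sub_smoothedIndicator hg hK, two_mul]
    rfl
  have hm1 : Measurable fun z => ∑ k ∈ Finset.range (ceilVol K),
      ENNReal.ofReal (1 - lam k) * ‖stft g (h k) z‖ₑ ^ 2 :=
    Finset.measurable_fun_sum _ fun k _ => (hmp k).const_mul _
  have hm2 : Measurable fun z => ∑' k,
      ENNReal.ofReal (lam (k + ceilVol K)) * ‖stft g (h (k + ceilVol K)) z‖ₑ ^ 2 :=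
    Measurable.tsum fun k => (hmp _).const_mul _
  have hm3 : Measurable fun z => (∑ k ∈ Finset.range (ceilVol K),
      ENNReal.ofReal (1 - lam k) * ‖stft g (h k) z‖ₑ ^ 2) + ∑' k,
      ENNReal.ofReal (lam (k + ceilVol K)) * ‖stft g (h (k + ceilVol K)) z‖ₑ ^ 2 := hm1.add hm2
  refine (lintegral_mono (hE.enorm_accSpec_sub_indicator_le hg hK)).trans ?_
  rw [lintegral_add_left hm3, lintegral_add_left hm1, hsecond,
    lintegral_finsetSum _ fun k _ => (hmp k).const_mul _,
    lintegral_tsum fun k => ((hmp _).const_mul _).aemeasurable]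
  calc _ ≤ (∑ k ∈ Finset.range (ceilVol K), ENNReal.ofReal (1 - lam k)) +
      (∑' k, ENNReal.ofReal (lam (k + ceilVol K))) + 2 * leakage g K := by
        gcongr with k _ k
        · exact hp1 _ _
        · exact hp1 _ _
    _ ≤ _ := add_le_add_left hfirst _
    _ = _ := by ring

end IsEigensystem

end AccumulatedSpectrogram

/-! ### Dilations of phase space -/

section Dilation

open scoped ENNReal

variable {d : ℕ}

/-- The mass that leaves `Ω` under the translation by `v` tends to `0` as `v → 0`. -/
theorem tendsto_volume_translate_diff {Ω : Set (Phase d)} (hΩ : IsCompact Ω) :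
    Tendsto (fun v : Phase d => volume {w | w ∈ Ω ∧ v + w ∉ Ω}) (𝓝 0) (𝓝 0) := by
  have hthick : Tendsto (fun v : Phase d => volume (Metric.cthickening ‖v‖ Ω) - volume Ω) (𝓝 0)
      (𝓝 0) := by
    have h1 := (tendsto_measure_cthickening_of_isCompact (μ := volume) hΩ).comp
      (tendsto_norm_zero (E := Phase d))
    have h2 := ENNReal.Tendsto.sub h1 (tendsto_const_nhds (x := volume Ω))
      (Or.inl hΩ.measure_lt_top.ne)
    rwa [tsub_self] at h2
  refine tendsto_of_tendsto_of_tendsto_of_le_of_le tendsto_const_nhds hthick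
    (fun _ => zero_le) fun v => ?_
  have hsub : v +ᵥ {w | w ∈ Ω ∧ v + w ∉ Ω} ⊆ Metric.cthickening ‖v‖ Ω \ Ω := by
    rintro _ ⟨w, ⟨hw, hvw⟩, rfl⟩
    refine ⟨Metric.mem_cthickening_of_dist_le _ w _ _ hw ?_, hvw⟩
    simp [dist_eq_norm]
  calc volume {w | w ∈ Ω ∧ v + w ∉ Ω} = volume (v +ᵥ {w | w ∈ Ω ∧ v + w ∉ Ω}) :=
        (measure_vadd volume v _).symm
    _ ≤ volume (Metric.cthickening ‖v‖ Ω \ Ω) := measure_mono hsub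
    _ = _ := measure_sdiff (Metric.self_subset_cthickening Ω) hΩ.measurableSet.nullMeasurableSet
        hΩ.measure_lt_top.ne

theorem measurable_volume_translate_diff {Ω : Set (Phase d)} (hΩ : MeasurableSet Ω) :
    Measurable fun v : Phase d => volume {w | w ∈ Ω ∧ v + w ∉ Ω} := by
  have hs : MeasurableSet {p : Phase d × Phase d | p.2 ∈ Ω ∧ p.1 + p.2 ∉ Ω} :=
    (measurable_snd hΩ).inter ((measurable_fst.add measurable_snd) hΩ).compl
  exact measurable_measure_prodMk_left hs

/-- The leakage as an average, with weight `|V_g g|²`, of the mass that leaves `K` under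
translations. -/
theorem leakage_eq_lintegral (g : L2 d) {K : Set (Phase d)} (hK : MeasurableSet K) :
    leakage g K = ∫⁻ u, ‖stft g g u‖ₑ ^ 2 * volume {w | w ∈ K ∧ u + w ∉ K} := by
  have hΦ := measurable_enorm_sq_stft g g
  unfold leakage smoothedIndicator
  rw [lintegral_lintegral_swap (measurable_stft_sub g).aemeasurable]
  have h1 : ∀ w : Phase d, ∫⁻ z in Kᶜ, ‖stft g g (z - w)‖ₑ ^ 2 =
      ∫⁻ u, Kᶜ.indicator (fun _ => ‖stft g g u‖ₑ ^ 2) (u + w) := fun w => by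
    rw [← lintegral_indicator hK.compl,
      ← lintegral_add_right_eq_self (Kᶜ.indicator fun z => ‖stft g g (z - w)‖ₑ ^ 2) w]
    refine lintegral_congr fun u => ?_
    by_cases hu : u + w ∈ Kᶜ
    · rw [Set.indicator_of_mem hu, Set.indicator_of_mem hu, add_sub_cancel_right]
    · rw [Set.indicator_of_notMem hu, Set.indicator_of_notMem hu]
  simp_rw [h1]
  have hind : Measurable fun p : Phase d × Phase d =>
      Kᶜ.indicator (fun _ => ‖stft g g p.2‖ₑ ^ 2) (p.2 + p.1) := by
    have hs : MeasurableSet {p : Phase d × Phase d | p.2 + p.1 ∈ Kᶜ} :=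
      (measurable_snd.add measurable_fst) hK.compl
    exact (hΦ.comp measurable_snd).indicator hs
  rw [lintegral_lintegral_swap hind.aemeasurable]
  refine lintegral_congr fun u => ?_
  have hs : MeasurableSet {w : Phase d | u + w ∉ K} := (measurable_const_add u hK).compl
  have h2 : ∀ w : Phase d, Kᶜ.indicator (fun _ => ‖stft g g u‖ₑ ^ 2) (u + w) =
      {w : Phase d | u + w ∉ K}.indicator (fun _ => ‖stft g g u‖ₑ ^ 2) w := fun w => rfl
  simp_rw [h2]
  rw [lintegral_indicator hs, setLIntegral_const, Measure.restrict_apply hs]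
  congr 2
  ext w
  exact and_comm

/-- The Jacobian factor `R^{-2d}` of the dilation `z ↦ R • z` of phase space. -/
noncomputable def jacobian (d : ℕ) (R : ℝ) : ℝ≥0∞ :=
  ENNReal.ofReal |(R ^ Module.finrank ℝ (Phase d))⁻¹|

theorem lintegral_comp_smul_phase {R : ℝ} (hR : 0 < R) {f : Phase d → ℝ≥0∞} (hf : Measurable f) :
    ∫⁻ z, f (R • z) = jacobian d R * ∫⁻ z, f z := by
  rw [← lintegral_map hf (measurable_const_smul R), Measure.map_addHaar_smul volume hR.ne',
    lintegral_smul_measure, jacobian, smul_eq_mul]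

theorem jacobian_mul_volume_smul {R : ℝ} (hR : 0 < R) (S : Set (Phase d)) :
    jacobian d R * volume (R • S) = volume S := by
  rw [Measure.addHaar_smul, jacobian, ← mul_assoc, ← ENNReal.ofReal_mul (abs_nonneg _), ← abs_mul,
    inv_mul_cancel₀ (pow_ne_zero _ hR.ne')]
  simp

theorem jacobian_mul_leakage_smul (g : L2 d) {Ω : Set (Phase d)} (hΩ : MeasurableSet Ω) {R : ℝ}
    (hR : 0 < R) : jacobian d R * leakage g (R • Ω) =
      ∫⁻ u, ‖stft g g u‖ₑ ^ 2 * volume {w | w ∈ Ω ∧ R⁻¹ • u + w ∉ Ω} := by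
  rw [leakage_eq_lintegral g (hΩ.const_smul_of_ne_zero hR.ne'),
    ← lintegral_const_mul' _ _ (show jacobian d R ≠ ∞ from ENNReal.ofReal_ne_top)]
  refine lintegral_congr fun u => ?_
  have h1 : {w | w ∈ R • Ω ∧ u + w ∉ R • Ω} = R • {w | w ∈ Ω ∧ R⁻¹ • u + w ∉ Ω} := by
    ext w
    simp only [Set.mem_ofPred_eq, Set.mem_smul_set_iff_inv_smul_mem₀ hR.ne', smul_add]
  rw [h1, mul_left_comm, jacobian_mul_volume_smul hR]

theorem tendsto_jacobian_mul_leakage {g : L2 d} (hg : ‖g‖ = 1) {Ω : Set (Phase d)}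
    (hΩ : IsCompact Ω) :
    Tendsto (fun R : ℝ => jacobian d R * leakage g (R • Ω)) atTop (𝓝 0) := by
  have hlim : Tendsto (fun R : ℝ =>
      ∫⁻ u, ‖stft g g u‖ₑ ^ 2 * volume {w | w ∈ Ω ∧ R⁻¹ • u + w ∉ Ω}) atTop
      (𝓝 (∫⁻ _ : Phase d, 0)) := by
    refine tendsto_lintegral_filter_of_dominated_convergence
      (fun u => ‖stft g g u‖ₑ ^ 2 * volume Ω) (Eventually.of_forall fun R => ?_)
      (Eventually.of_forall fun R => Eventually.of_forall fun u => ?_) ?_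
      (Eventually.of_forall fun u => ?_)
    · exact (measurable_enorm_sq_stft g g).mul
        ((measurable_volume_translate_diff hΩ.measurableSet).comp (measurable_const_smul R⁻¹))
    · gcongr
      exact fun w hw => hw.1
    · rw [lintegral_mul_const _ (measurable_enorm_sq_stft g g), lintegral_enorm_sq_stft_self hg,
        one_mul]
      exact hΩ.measure_lt_top.ne
    · have h1 : Tendsto (fun R : ℝ => R⁻¹ • u) atTop (𝓝 0) := by
        simpa using (tendsto_inv_atTop_zero (𝕜 := ℝ)).smul_const u
      have h2 := ENNReal.Tendsto.const_mul (a := ‖stft g g u‖ₑ ^ 2)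
        ((tendsto_volume_translate_diff hΩ).comp h1) (Or.inr (by simp))
      simpa using! h2
  rw [lintegral_zero] at hlim
  refine hlim.congr' ?_
  filter_upwards [eventually_gt_atTop 0] with R hR
  exact (jacobian_mul_leakage_smul g hΩ.measurableSet hR).symm

/-- The rounding error `⌈|RΩ|⌉ - |RΩ|` is negligible: for `d ≥ 1` it is bounded, and phase space has
volume growth `R^{2d}`; for `d = 0` every set has measure `0` or `1`. -/
theorem tendsto_jacobian_mul_ceilVol_sub (Ω : Set (Phase d)) :
    Tendsto (fun R : ℝ => jacobian d R *
      ENNReal.ofReal (ceilVol (R • Ω) - (volume (R • Ω)).toReal)) atTop (𝓝 0) := by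
  rcases Nat.eq_zero_or_pos d with rfl | hd
  · have hvol : ∀ S : Set (Phase 0), ENNReal.ofReal (ceilVol S - (volume S).toReal) = 0 := by
      intro S
      have huniv : volume (Set.univ : Set (Phase 0)) = 1 := by
        have h1 : volume (Set.univ : Set (Rn 0)) = 1 := by
          have := (EuclideanSpace.volume_preserving_symm_measurableEquiv_toLp (Fin 0)).measure_preimage
            (s := Set.univ) MeasurableSet.univ.nullMeasurableSet
          rw [Set.preimage_univ] at this
          rw [this]
          simp [volume_pi]
        rw [Measure.volume_eq_prod, ← Set.univ_prod_univ, Measure.prod_prod, h1, one_mul]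
      rcases S.eq_empty_or_nonempty with rfl | hS
      · simp [ceilVol]
      · rw [Subsingleton.eq_univ_of_nonempty hS]
        simp [ceilVol, huniv]
    simp only [hvol, mul_zero]
    exact tendsto_const_nhds
  · have hn : Module.finrank ℝ (Phase d) ≠ 0 := by
      simp [Module.finrank_prod]
      omega
    have h1 : Tendsto (fun R : ℝ => jacobian d R) atTop (𝓝 0) := by
      have h2 : Tendsto (fun R : ℝ => |(R ^ Module.finrank ℝ (Phase d))⁻¹|) atTop (𝓝 0) := by
        simpa using ((tendsto_pow_atTop (α := ℝ) hn).inv_tendsto_atTop).abs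
      simpa [jacobian] using! ENNReal.tendsto_ofReal h2
    refine tendsto_of_tendsto_of_tendsto_of_le_of_le tendsto_const_nhds h1
      (fun _ => zero_le) fun R => ?_
    refine mul_le_of_le_one_right' ?_
    rw [ENNReal.ofReal_le_one, ceilVol]
    linarith [Nat.ceil_lt_add_one (ENNReal.toReal_nonneg (a := volume (R • Ω)))]

end Dilation

/-! ### Convergence of the rescaled accumulated spectrograms -/

theorem theorem1p3 (d : ℕ) (g : L2 d) (hg : ‖g‖ = 1) (Ω : Set (Phase d)) (hΩ : IsCompact Ω) :
    -- the eigensystems that define the accumulated spectrograms exist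
    (∀ R : ℝ, 0 < R → ∃ (lam : ℕ → ℝ) (h : ℕ → L2 d), IsEigensystem g (R • Ω) lam h) ∧
    -- and for every choice of them the rescaled accumulated spectrograms converge in `L¹`
    ∀ (lam : ℝ → ℕ → ℝ) (h : ℝ → ℕ → L2 d),
      (∀ R : ℝ, 0 < R → IsEigensystem g (R • Ω) (lam R) (h R)) →
      (∀ R : ℝ, 0 < R → Integrable (fun z : Phase d => accSpec g (R • Ω) (h R) (R • z)) volume) ∧
      Tendsto
        (fun R : ℝ => eLpNorm
          (fun z : Phase d => accSpec g (R • Ω) (h R) (R • z) - Ω.indicator (fun _ => (1 : ℝ)) z)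
          1 volume)
        atTop (𝓝 0) := by
  refine ⟨fun R _ => exists_isEigensystem g (hΩ.smul R), fun lam h hE => ⟨fun R hR =>
    (integrable_accSpec g (R • Ω) (h R)).comp_smul hR.ne', ?_⟩⟩
  have hbound : Tendsto (fun R : ℝ => jacobian d R *
      ENNReal.ofReal (ceilVol (R • Ω) - (volume (R • Ω)).toReal) +
      4 * (jacobian d R * leakage g (R • Ω))) atTop (𝓝 0) := by
    simpa using (tendsto_jacobian_mul_ceilVol_sub Ω).add
      (ENNReal.Tendsto.const_mul (a := 4) (tendsto_jacobian_mul_leakage hg hΩ)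
        (Or.inr (by norm_num)))
  refine tendsto_of_tendsto_of_tendsto_of_le_of_le' tendsto_const_nhds hbound
    (Eventually.of_forall fun _ => zero_le) ?_
  filter_upwards [eventually_gt_atTop 0] with R hR
  have hK : IsCompact (R • Ω) := hΩ.smul R
  have hmeas : Measurable fun z => ‖accSpec g (R • Ω) (h R) z -
      (R • Ω).indicator (fun _ => (1 : ℝ)) z‖ₑ :=
    ((continuous_accSpec g (R • Ω) (h R)).measurable.sub
      (measurable_const.indicator hK.measurableSet)).enorm
  have hind : ∀ z : Phase d, Ω.indicator (fun _ => (1 : ℝ)) z =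
      (R • Ω).indicator (fun _ => (1 : ℝ)) (R • z) := fun z => by
    by_cases hz : z ∈ Ω
    · rw [Set.indicator_of_mem hz, Set.indicator_of_mem (Set.smul_mem_smul_set hz)]
    · rw [Set.indicator_of_notMem hz,
        Set.indicator_of_notMem (by rwa [Set.smul_mem_smul_set_iff₀ hR.ne'])]
  rw [eLpNorm_one_eq_lintegral_enorm]
  simp_rw [hind]
  rw [lintegral_comp_smul_phase hR hmeas]
  refine (mul_le_mul_right ((hE R hR).lintegral_accSpec_sub_indicator_le hg hK) _).trans_eq ?_
  ring
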